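/- For $0\le k<1$ let $K(k)=\int_0^{\pi/2}\frac{d\theta}{\sqrt{1-k^2\sin^2\theta}}$ and $E(k)=\int_0^{\pi/2}\sqrt{1-k^2\sin^2\theta}\,d\theta$ be the complete elliptic integrals of the first and second kind with modulus $k$, and for $0<x\le 16$ put $$V_4(x)=\frac{1}{15\pi^2}\left[\left(\frac{64}{\sqrt x}+56\sqrt x+\frac{x^{3/2}}{4}\right)E\!\left(\sqrt{1-\tfrac{x}{16}}\right)-2\sqrt x\,(16+x)\,K\!\left(\sqrt{1-\tfrac{x}{16}}\right)\right].$$ Then $V_4$ is integrable on $(0,16)$ and solves the Hausdorff moment problem $$\int_0^{16}x^n\,V_4(x)\,dx=\frac{6\,(2n)!\,(2n+2)!}{\prod_{r=0}^{3}(n+r)!},\qquad n=0,1,2,\dots.$$ Moreover $V_4(x)>0$ for $0<x<16$, and $V_4$ is the unique solution: every integrable function $W:(0,16)\to\mathbb R$ with these moments equals $V_4$ almost everywhere on $(0,16)$. -/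

import Mathlib

open MeasureTheory

noncomputable section

/-- Complete elliptic integral of the first kind, as a function of the modulus `k` (`|k| < 1`). -/
def ellipticK (k : ℝ) : ℝ :=
  ∫ θ in (0 : ℝ)..(Real.pi / 2), 1 / √(1 - k ^ 2 * Real.sin θ ^ 2)

/-- Complete elliptic integral of the second kind, as a function of the modulus `k` (`|k| ≤ 1`). -/
def ellipticE (k : ℝ) : ℝ :=
  ∫ θ in (0 : ℝ)..(Real.pi / 2), √(1 - k ^ 2 * Real.sin θ ^ 2)

/-- The sequence `D₄(n) = 6 (2n)! (2n+2)! / ∏_{r=0}^{3} (n+r)!`, as a real number. -/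
def D4 (n : ℕ) : ℝ :=
  6 * ((2 * n).factorial : ℝ) * ((2 * n + 2).factorial : ℝ) /
    ∏ r ∈ Finset.range 4, ((n + r).factorial : ℝ)

/-- `V` is a weight on `[0, 16]` whose `n`-th power moment exists and equals `D₄(n)`, for all `n`. -/
def SolvesMomentProblem (V : ℝ → ℝ) : Prop :=
  ∀ n : ℕ, IntervalIntegrable (fun x : ℝ => x ^ n * V x) volume 0 16 ∧
    ∫ x in (0 : ℝ)..16, x ^ n * V x = D4 n

/-- The closed form of the weight (meaningful for `0 < x ≤ 16`). -/
def V4 (x : ℝ) : ℝ :=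
  1 / (15 * Real.pi ^ 2) *
    ((64 / √x + 56 * √x + x ^ (3 / 2 : ℝ) / 4) * ellipticE (√(1 - x / 16))
      - 2 * √x * (16 + x) * ellipticK (√(1 - x / 16)))

end

/-!
Write `ρ = √(1 - y²)`. Integrating the derivative of a suitable elementary function over a quarter
period turns the combination of `E(ρ)` and `K(ρ)` in `V₄(16 y²)` into a single integral with
positive integrand,
`V₄(16 y²) = 16 / (3 π² y) ∫₀^{π/2} (ρ cos θ)⁴ (ρ sin θ)⁴ / (1 - ρ² sin² θ)^{3/2} dθ`,
so `V₄ > 0`. After the substitution `x = 16 y²` the `n`-th moment is, up to a constant, the integral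
of `y^{2n} z⁴ c⁴ / (1 - c²)^{3/2}` over the octant `y² + c² + z² = 1`, `y, c, z > 0`, because
Archimedes' coordinates `(y, c, z) = (y, ρ sin θ, ρ cos θ)` turn surface measure into `dy dθ`.
Taking the cylindrical coordinates along the `c`-axis instead separates the variables, and the
moment becomes a product of two trigonometric beta integrals. Uniqueness holds because polynomials
are dense in the continuous functions on `[0, 16]`.
-/

section EllipticIntegrals

open Real Set

theorem sin_pos_and_cos_pos_of_mem_Ioo {θ : ℝ} (hθ : θ ∈ Ioo 0 (π / 2)) :
    0 < sin θ ∧ 0 < cos θ :=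
  ⟨sin_pos_of_mem_Ioo (Ioo_subset_Ioo_right (half_le_self pi_pos.le) hθ),
    cos_pos_of_mem_Ioo (Ioo_subset_Ioo_left (by linarith [pi_pos]) hθ)⟩

theorem sq_sqrt_one_sub_sq_lt_one {y : ℝ} (hy : y ≠ 0) : √(1 - y ^ 2) ^ 2 < 1 := by
  rw [sq_sqrt', max_lt_iff]
  exact ⟨by linarith [sq_pos_of_ne_zero hy], one_pos⟩

theorem one_sub_mul_sin_sq_pos {m : ℝ} (hm : m < 1) (θ : ℝ) : 0 < 1 - m * sin θ ^ 2 := by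
  rcases le_total m 0 with h | h <;> nlinarith [sin_sq_le_one θ, sq_nonneg (sin θ)]

theorem measurable_ellipticK : Measurable ellipticK := by
  unfold ellipticK
  simp only [intervalIntegral.integral_of_le pi_div_two_pos.le]
  have hinner : StronglyMeasurable fun p : ℝ × ℝ => 1 / √(1 - p.1 ^ 2 * sin p.2 ^ 2) :=
    Measurable.stronglyMeasurable (by fun_prop)
  exact hinner.integral_prod_right'.measurable

theorem measurable_ellipticE : Measurable ellipticE := by
  unfold ellipticE
  simp only [intervalIntegral.integral_of_le pi_div_two_pos.le]
  have hinner : StronglyMeasurable fun p : ℝ × ℝ => √(1 - p.1 ^ 2 * sin p.2 ^ 2) :=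
    Measurable.stronglyMeasurable (by fun_prop)
  exact hinner.integral_prod_right'.measurable

theorem continuous_cos_pow_mul_sin_pow_div {k : ℝ} (hk : k ^ 2 < 1) :
    Continuous fun θ => (k * cos θ) ^ 4 * ((k * sin θ) ^ 4 / √(1 - (k * sin θ) ^ 2) ^ 3) := by
  refine Continuous.mul (by fun_prop) (Continuous.div (by fun_prop) (by fun_prop) fun θ => ?_)
  rw [mul_pow]
  exact pow_ne_zero 3 (sqrt_pos.2 (one_sub_mul_sin_sq_pos hk θ)).ne'

/-- The antiderivative comes from the ansatz `sin θ cos θ P(sin² θ) / √(1 - k² sin² θ)` with `P`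
quadratic; matching coefficients determines `P` and the two polynomial weights. -/
theorem hasDerivAt_sin_mul_cos_mul_div_sqrt {k : ℝ} (hk : k ^ 2 < 1) (θ : ℝ) :
    HasDerivAt
      (fun θ => k ^ 2 * (sin θ * cos θ *
        (8 - 7 * k ^ 2 - 2 * k ^ 2 * (1 - k ^ 2) * sin θ ^ 2 - k ^ 4 * sin θ ^ 4)) /
          √(1 - k ^ 2 * sin θ ^ 2))
      ((16 - 16 * k ^ 2 + k ^ 4) * √(1 - k ^ 2 * sin θ ^ 2)
        - 8 * (1 - k ^ 2) * (2 - k ^ 2) * (1 / √(1 - k ^ 2 * sin θ ^ 2))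
        - 5 * ((k * cos θ) ^ 4 * ((k * sin θ) ^ 4 / √(1 - (k * sin θ) ^ 2) ^ 3))) θ := by
  have hpos := one_sub_mul_sin_sq_pos hk θ
  have hsqrt_pos : 0 < √(1 - k ^ 2 * sin θ ^ 2) := sqrt_pos.2 hpos
  have hsqrt_sq : √(1 - k ^ 2 * sin θ ^ 2) ^ 2 = 1 - k ^ 2 * sin θ ^ 2 := sq_sqrt hpos.le
  have hcos_sq : cos θ ^ 2 = 1 - sin θ ^ 2 := cos_sq' θ
  have hcos_pow : cos θ ^ 4 = (1 - sin θ ^ 2) ^ 2 := by rw [← hcos_sq]; ring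
  have hsin_pow (n : ℕ) : HasDerivAt (fun θ => sin θ ^ n) (n * sin θ ^ (n - 1) * cos θ) θ :=
    (hasDerivAt_sin θ).fun_pow n
  have hsqrt := (((hsin_pow 2).const_mul (k ^ 2)).const_sub 1).sqrt hpos.ne'
  have hpoly := (((hsin_pow 2).const_mul (2 * k ^ 2 * (1 - k ^ 2))).const_sub
    (8 - 7 * k ^ 2)).fun_sub ((hsin_pow 4).const_mul (k ^ 4))
  have hnum := (((hasDerivAt_sin θ).fun_mul (hasDerivAt_cos θ)).fun_mul hpoly).const_mul (k ^ 2)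
  refine (hnum.fun_div hsqrt hsqrt_pos.ne').congr_deriv ?_
  simp only [mul_pow]
  field_simp
  simp only [hsqrt_sq, hcos_sq, hcos_pow]
  push_cast
  ring

theorem ellipticE_ellipticK_combination_eq_integral {k : ℝ} (hk : k ^ 2 < 1) :
    (16 - 16 * k ^ 2 + k ^ 4) * ellipticE k - 8 * (1 - k ^ 2) * (2 - k ^ 2) * ellipticK k =
      5 * ∫ θ in (0 : ℝ)..(π / 2),
        (k * cos θ) ^ 4 * ((k * sin θ) ^ 4 / √(1 - (k * sin θ) ^ 2) ^ 3) := by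
  have hE : Continuous fun θ => (16 - 16 * k ^ 2 + k ^ 4) * √(1 - k ^ 2 * sin θ ^ 2) := by
    fun_prop
  have hK : Continuous fun θ =>
      8 * (1 - k ^ 2) * (2 - k ^ 2) * (1 / √(1 - k ^ 2 * sin θ ^ 2)) :=
    continuous_const.mul (continuous_const.div (by fun_prop) fun θ =>
      (sqrt_pos.2 (one_sub_mul_sin_sq_pos hk θ)).ne')
  have hEK := hE.fun_sub hK
  have hJ := (continuous_cos_pow_mul_sin_pow_div hk).const_mul 5
  have hFTC := intervalIntegral.integral_eq_sub_of_hasDerivAt (a := 0) (b := π / 2)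
    (fun θ _ => hasDerivAt_sin_mul_cos_mul_div_sqrt hk θ)
    ((hEK.fun_sub hJ).intervalIntegrable _ _)
  rw [intervalIntegral.integral_sub (hEK.intervalIntegrable _ _) (hJ.intervalIntegrable _ _),
    intervalIntegral.integral_sub (hE.intervalIntegrable _ _) (hK.intervalIntegrable _ _)] at hFTC
  simp only [intervalIntegral.integral_const_mul, sin_zero, cos_pi_div_two, mul_zero, zero_mul,
    zero_div, sub_zero] at hFTC
  exact sub_eq_zero.1 hFTC

theorem V4_sixteen_mul_sq {y : ℝ} (hy : y ∈ Ioo (0 : ℝ) 1) :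
    V4 (16 * y ^ 2) = 16 / (3 * π ^ 2 * y) * ∫ θ in (0 : ℝ)..(π / 2),
      (√(1 - y ^ 2) * cos θ) ^ 4 *
        ((√(1 - y ^ 2) * sin θ) ^ 4 / √(1 - (√(1 - y ^ 2) * sin θ) ^ 2) ^ 3) := by
  obtain ⟨hy0, hy1⟩ := hy
  have hsqrt : √(16 * y ^ 2) = 4 * y := by
    rw [show 16 * y ^ 2 = (4 * y) ^ 2 by ring, sqrt_sq (by positivity)]
  have hrpow : (16 * y ^ 2) ^ (3 / 2 : ℝ) = 64 * y ^ 3 := by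
    rw [show (3 / 2 : ℝ) = 1 / 2 * (3 : ℕ) by norm_num, rpow_mul (by positivity),
      ← sqrt_eq_rpow, hsqrt, rpow_natCast]
    ring
  have hk : √(1 - y ^ 2) ^ 2 = 1 - y ^ 2 := sq_sqrt (by nlinarith)
  have hcomb := ellipticE_ellipticK_combination_eq_integral (sq_sqrt_one_sub_sq_lt_one hy0.ne')
  rw [show √(1 - y ^ 2) ^ 4 = (√(1 - y ^ 2) ^ 2) ^ 2 by ring, hk] at hcomb
  rw [eq_div_of_mul_eq (by norm_num) ((mul_comm _ _).trans hcomb.symm), V4, hsqrt, hrpow,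
    show 1 - 16 * y ^ 2 / 16 = 1 - y ^ 2 by ring]
  field_simp
  ring

theorem measurable_V4 : Measurable V4 := by
  have hmodulus : Measurable fun x : ℝ => √(1 - x / 16) := by fun_prop
  have hE := measurable_ellipticE.comp hmodulus
  have hK := measurable_ellipticK.comp hmodulus
  exact measurable_const.mul
    ((Measurable.mul (by fun_prop) hE).sub (Measurable.mul (by fun_prop) hK))

theorem V4_pos {x : ℝ} (hx : x ∈ Ioo (0 : ℝ) 16) : 0 < V4 x := by
  obtain ⟨hx0, hx16⟩ := hx
  obtain ⟨y, hy, rfl⟩ : ∃ y ∈ Ioo (0 : ℝ) 1, 16 * y ^ 2 = x := by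
    refine ⟨√(x / 16), ⟨by positivity, ?_⟩, ?_⟩
    · rw [sqrt_lt' one_pos]; linarith
    · rw [sq_sqrt (by positivity)]; ring
  have hy0 := hy.1
  have hk : 0 < 1 - y ^ 2 := by nlinarith [hy.2]
  have hk1 := sq_sqrt_one_sub_sq_lt_one hy0.ne'
  rw [V4_sixteen_mul_sq hy]
  refine mul_pos (by positivity) (intervalIntegral.intervalIntegral_pos_of_pos_on
    ((continuous_cos_pow_mul_sin_pow_div hk1).intervalIntegrable _ _) (fun θ hθ => ?_)
    (by positivity))
  obtain ⟨hsin, hcos⟩ := sin_pos_and_cos_pos_of_mem_Ioo hθ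
  have hD := one_sub_mul_sin_sq_pos hk1 θ
  rw [← mul_pow] at hD
  positivity

end EllipticIntegrals

section OctantSphere

open Real Set
open scoped ENNReal

theorem setLIntegral_Ioo_eq_setLIntegral_deriv_mul {a b : ℝ} {g g' : ℝ → ℝ} (hab : a ≤ b)
    (hcont : ContinuousOn g (Icc a b)) (hmono : StrictMonoOn g (Icc a b))
    (hderiv : ∀ t ∈ Ioo a b, HasDerivAt g (g' t) t) (f : ℝ → ℝ≥0∞) :
    ∫⁻ x in Ioo (g a) (g b), f x = ∫⁻ t in Ioo a b, ENNReal.ofReal (g' t) * f (g t) := by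
  rw [← hcont.image_Ioo_of_strictMonoOn hab hmono]
  exact lintegral_image_eq_lintegral_deriv_mul_of_monotoneOn measurableSet_Ioo
    (fun t ht => (hderiv t ht).hasDerivWithinAt) (hmono.mono Ioo_subset_Icc_self).monotoneOn f

theorem setLIntegral_Ioo_one_div_sqrt_mul {r : ℝ} (hr : 0 < r) (h : ℝ → ℝ → ℝ≥0∞) :
    ∫⁻ t in Ioo 0 r, ENNReal.ofReal (1 / √(r ^ 2 - t ^ 2)) * h t √(r ^ 2 - t ^ 2) =
      ∫⁻ θ in Ioo 0 (π / 2), h (r * sin θ) (r * cos θ) := by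
  have hsubst := setLIntegral_Ioo_eq_setLIntegral_deriv_mul (g := fun θ => r * sin θ)
    (g' := fun θ => r * cos θ) (a := 0) (b := π / 2) (by positivity) (by fun_prop)
    (fun θ hθ ψ hψ hlt => mul_lt_mul_of_pos_left
      (sin_lt_sin_of_lt_of_le_pi_div_two (by linarith [hθ.1, pi_pos]) hψ.2 hlt) hr)
    (fun θ _ => (hasDerivAt_sin θ).const_mul r)
    (fun t => ENNReal.ofReal (1 / √(r ^ 2 - t ^ 2)) * h t √(r ^ 2 - t ^ 2))
  simp only [sin_zero, sin_pi_div_two, mul_zero, mul_one] at hsubst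
  rw [hsubst]
  refine setLIntegral_congr_fun measurableSet_Ioo fun θ hθ => ?_
  have hcos : 0 < r * cos θ :=
    mul_pos hr (sin_pos_and_cos_pos_of_mem_Ioo hθ).2
  have hsqrt : √(r ^ 2 - (r * sin θ) ^ 2) = r * cos θ := by
    rw [← sqrt_sq hcos.le, mul_pow, mul_pow, cos_sq']
    ring_nf
  simp only [hsqrt]
  rw [← mul_assoc, ← ENNReal.ofReal_mul hcos.le, mul_one_div_cancel hcos.ne', ENNReal.ofReal_one,
    one_mul]

theorem setLIntegral_Ioo_one_div_sqrt_mul_of_le {r R : ℝ} (hr : 0 < r) (hR : r ≤ R)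
    (h : ℝ → ℝ → ℝ≥0∞) :
    ∫⁻ t in Ioo 0 R, ENNReal.ofReal (1 / √(r ^ 2 - t ^ 2)) * h t √(r ^ 2 - t ^ 2) =
      ∫⁻ θ in Ioo 0 (π / 2), h (r * sin θ) (r * cos θ) := by
  -- For `r ≤ t < R` the square root is `0` and so is `1 / 0`.
  have hzero : ∫⁻ t in Ico r R, ENNReal.ofReal (1 / √(r ^ 2 - t ^ 2)) * h t √(r ^ 2 - t ^ 2) = 0 :=
    setLIntegral_eq_zero measurableSet_Ico fun t ht => by
      simp only [sqrt_eq_zero_of_nonpos (show r ^ 2 - t ^ 2 ≤ 0 by nlinarith [ht.1]), div_zero,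
        ENNReal.ofReal_zero, zero_mul, Pi.zero_apply]
  rw [← setLIntegral_Ioo_one_div_sqrt_mul hr, ← Ioo_union_Ico_eq_Ioo hr hR,
    lintegral_union measurableSet_Ico (Ico_disjoint_Ico_same.mono_left Ioo_subset_Ico_self), hzero,
    add_zero]

/-- Both sides integrate `F` over the positive octant of the unit sphere with respect to surface
measure, in Archimedes' cylindrical coordinates along the first and along the second axis. -/
theorem lintegral_octant_swap {F : ℝ × ℝ × ℝ → ℝ≥0∞} (hF : Measurable F) :
    ∫⁻ y in Ioo 0 1, ∫⁻ θ in Ioo 0 (π / 2), F (y, √(1 - y ^ 2) * sin θ, √(1 - y ^ 2) * cos θ) =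
      ∫⁻ c in Ioo 0 1, ∫⁻ θ in Ioo 0 (π / 2),
        F (√(1 - c ^ 2) * sin θ, c, √(1 - c ^ 2) * cos θ) := by
  have hradius {y : ℝ} (hy : y ∈ Ioo (0 : ℝ) 1) :
      0 < √(1 - y ^ 2) ∧ √(1 - y ^ 2) ≤ 1 ∧ √(1 - y ^ 2) ^ 2 = 1 - y ^ 2 := by
    have hpos : 0 < 1 - y ^ 2 := by nlinarith [hy.1, hy.2]
    exact ⟨sqrt_pos.2 hpos, sqrt_le_one.2 (by nlinarith), sq_sqrt hpos.le⟩
  have hmeas : Measurable fun p : ℝ × ℝ =>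
      ENNReal.ofReal (1 / √(1 - p.1 ^ 2 - p.2 ^ 2)) * F (p.1, p.2, √(1 - p.1 ^ 2 - p.2 ^ 2)) := by
    fun_prop
  calc _ = ∫⁻ y in Ioo 0 1, ∫⁻ c in Ioo 0 1,
        ENNReal.ofReal (1 / √(1 - y ^ 2 - c ^ 2)) * F (y, c, √(1 - y ^ 2 - c ^ 2)) := by
        refine setLIntegral_congr_fun measurableSet_Ioo fun y hy => ?_
        obtain ⟨hpos, hle, hsq⟩ := hradius hy
        rw [← setLIntegral_Ioo_one_div_sqrt_mul_of_le hpos hle fun c z => F (y, c, z), hsq]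
    _ = ∫⁻ c in Ioo 0 1, ∫⁻ y in Ioo 0 1,
        ENNReal.ofReal (1 / √(1 - y ^ 2 - c ^ 2)) * F (y, c, √(1 - y ^ 2 - c ^ 2)) :=
      lintegral_lintegral_swap hmeas.aemeasurable
    _ = _ := by
        refine setLIntegral_congr_fun measurableSet_Ioo fun c hc => ?_
        obtain ⟨hpos, hle, hsq⟩ := hradius hc
        rw [← setLIntegral_Ioo_one_div_sqrt_mul_of_le hpos hle fun y z => F (y, c, z), hsq]
        simp only [sub_right_comm]

theorem lintegral_octant_pow_mul_pow_mul (s q : ℕ) {G : ℝ → ℝ≥0∞} (hG : Measurable G) :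
    ∫⁻ y in Ioo 0 1, ∫⁻ θ in Ioo 0 (π / 2),
        ENNReal.ofReal (y ^ s * (√(1 - y ^ 2) * cos θ) ^ q) * G (√(1 - y ^ 2) * sin θ) =
      (∫⁻ θ in Ioo 0 (π / 2), ENNReal.ofReal (sin θ ^ s * cos θ ^ q)) *
        ∫⁻ α in Ioo 0 (π / 2), ENNReal.ofReal (cos α ^ (s + q + 1)) * G (sin α) := by
  have hmeas : Measurable fun p : ℝ × ℝ × ℝ => ENNReal.ofReal (p.1 ^ s * p.2.2 ^ q) * G p.2.1 := by
    fun_prop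
  have hinner (c : ℝ) : ∫⁻ θ in Ioo 0 (π / 2), ENNReal.ofReal
        ((√(1 - c ^ 2) * sin θ) ^ s * (√(1 - c ^ 2) * cos θ) ^ q) * G c =
      (∫⁻ θ in Ioo 0 (π / 2), ENNReal.ofReal (sin θ ^ s * cos θ ^ q)) *
        (ENNReal.ofReal (√(1 - c ^ 2) ^ (s + q)) * G c) := by
    rw [← lintegral_mul_const _ (by fun_prop)]
    refine lintegral_congr fun θ => ?_
    rw [← mul_assoc, ← ENNReal.ofReal_mul' (by positivity)]
    ring_nf
  have hsin := setLIntegral_Ioo_one_div_sqrt_mul one_pos fun c z =>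
    ENNReal.ofReal (z ^ (s + q + 1)) * G c
  simp only [one_pow, one_mul] at hsin
  rw [lintegral_octant_swap hmeas, ← hsin, ← lintegral_const_mul _ (by fun_prop)]
  refine setLIntegral_congr_fun measurableSet_Ioo fun c hc => ?_
  have hpos : 0 < √(1 - c ^ 2) := sqrt_pos.2 (by nlinarith [hc.1, hc.2])
  simp only [hinner]
  rw [← mul_assoc (ENNReal.ofReal (1 / _)), ← ENNReal.ofReal_mul (by positivity),
    pow_succ' _ (s + q), ← mul_assoc (1 / _), one_div_mul_cancel hpos.ne', one_mul]

end OctantSphere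

section Moments

open Real Set
open scoped Nat

theorem ofReal_intervalIntegral_eq_setLIntegral_Ioo {a b : ℝ} {f : ℝ → ℝ} (hab : a ≤ b)
    (hint : IntervalIntegrable f volume a b) (hf : ∀ t ∈ Ioo a b, 0 ≤ f t) :
    ENNReal.ofReal (∫ t in a..b, f t) = ∫⁻ t in Ioo a b, ENNReal.ofReal (f t) := by
  rw [intervalIntegral.integral_of_le hab, integral_Ioc_eq_integral_Ioo]
  exact ofReal_integral_eq_lintegral_ofReal
    ((intervalIntegrable_iff_integrableOn_Ioo_of_le hab).1 hint)
    ((ae_restrict_iff' measurableSet_Ioo).2 (.of_forall hf))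

/-- Half of the Euler beta function at `((p + 1) / 2, (q + 1) / 2)`, in its trigonometric form. -/
noncomputable def trigBeta (p q : ℕ) : ℝ :=
  ∫ θ in (0 : ℝ)..(π / 2), sin θ ^ p * cos θ ^ q

theorem ofReal_trigBeta (p q : ℕ) :
    ENNReal.ofReal (trigBeta p q) =
      ∫⁻ θ in Ioo 0 (π / 2), ENNReal.ofReal (sin θ ^ p * cos θ ^ q) := by
  refine ofReal_intervalIntegral_eq_setLIntegral_Ioo (by positivity)
    (Continuous.intervalIntegrable (by fun_prop) _ _) fun θ hθ => ?_
  obtain ⟨hsin, hcos⟩ := sin_pos_and_cos_pos_of_mem_Ioo hθ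
  positivity

theorem trigBeta_add_two_zero (p : ℕ) :
    trigBeta (p + 2) 0 = (p + 1) / (p + 2) * trigBeta p 0 := by
  simp [trigBeta, integral_sin_pow]

theorem trigBeta_add_two_right (p q : ℕ) :
    trigBeta p (q + 2) = trigBeta p q - trigBeta (p + 2) q := by
  unfold trigBeta
  rw [← intervalIntegral.integral_sub (Continuous.intervalIntegrable (by fun_prop) _ _)
    (Continuous.intervalIntegrable (by fun_prop) _ _)]
  congr 1 with θ
  rw [pow_add (cos θ), cos_sq']
  ring

theorem trigBeta_two_mul_two_mul (a b : ℕ) :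
    trigBeta (2 * a) (2 * b) =
      π / 2 * ((2 * a)! * (2 * b)! / (4 ^ (a + b) * a ! * b ! * (a + b)!)) := by
  induction b generalizing a with
  | zero =>
    induction a with
    | zero => simp [trigBeta]
    | succ a ih =>
      simp only [mul_zero, mul_add, mul_one, add_zero] at ih ⊢
      rw [trigBeta_add_two_zero, ih]
      push_cast [Nat.factorial_succ]
      field_simp
      ring
  | succ b ih =>
    have hab : a + 1 + b = a + b + 1 := by ring
    rw [mul_add, mul_one, trigBeta_add_two_right, ih, ← mul_add_one, ih, hab, ← add_assoc a b 1]
    simp only [mul_add, mul_one]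
    push_cast [Nat.factorial_succ]
    field_simp
    ring

theorem trigBeta_mul_trigBeta_eq_D4 (n : ℕ) :
    16 ^ n * 512 / (3 * π ^ 2) * (trigBeta (2 * n) 4 * trigBeta 4 (2 * n + 2)) = D4 n := by
  rw [show trigBeta (2 * n) 4 = _ from trigBeta_two_mul_two_mul n 2,
    show trigBeta 4 (2 * n + 2) = _ from trigBeta_two_mul_two_mul 2 (n + 1), D4,
    show 2 + (n + 1) = n + 3 by ring]
  simp only [Finset.prod_range_succ, Finset.prod_range_zero, add_zero, one_mul, mul_add, mul_one,
    show (16 : ℝ) ^ n = 4 ^ n * 4 ^ n by rw [← mul_pow]; norm_num]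
  push_cast [Nat.factorial_succ]
  norm_num [Nat.factorial_succ]
  field_simp
  ring

theorem ofReal_mul_pow_mul_V4_sixteen_mul_sq (n : ℕ) {y : ℝ} (hy : y ∈ Ioo (0 : ℝ) 1) :
    ENNReal.ofReal (32 * y) * ENNReal.ofReal ((16 * y ^ 2) ^ n * V4 (16 * y ^ 2)) =
      ENNReal.ofReal (16 ^ n * 512 / (3 * π ^ 2)) * ∫⁻ θ in Ioo 0 (π / 2),
        ENNReal.ofReal (y ^ (2 * n) * (√(1 - y ^ 2) * cos θ) ^ 4) *
          ENNReal.ofReal ((√(1 - y ^ 2) * sin θ) ^ 4 / √(1 - (√(1 - y ^ 2) * sin θ) ^ 2) ^ 3) := by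
  have hy0 := hy.1
  have hinner : ∀ θ : ℝ, 0 ≤ y ^ (2 * n) * ((√(1 - y ^ 2) * cos θ) ^ 4 *
      ((√(1 - y ^ 2) * sin θ) ^ 4 / √(1 - (√(1 - y ^ 2) * sin θ) ^ 2) ^ 3)) := fun θ => by
    positivity
  have hcont := (continuous_cos_pow_mul_sin_pow_div (sq_sqrt_one_sub_sq_lt_one hy0.ne')).const_mul
    (y ^ (2 * n))
  simp only [← ENNReal.ofReal_mul (mul_nonneg (pow_nonneg hy0.le _) (Even.pow_nonneg ⟨2, rfl⟩ _)),
    mul_assoc]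
  rw [← ofReal_intervalIntegral_eq_setLIntegral_Ioo (by positivity)
      (hcont.intervalIntegrable _ _) fun θ _ => hinner θ,
    ← ENNReal.ofReal_mul (by positivity), ← ENNReal.ofReal_mul (by positivity),
    V4_sixteen_mul_sq hy, intervalIntegral.integral_const_mul]
  congr 1
  field_simp
  ring

theorem lintegral_pow_mul_V4 (n : ℕ) :
    ∫⁻ x in Ioo 0 16, ENNReal.ofReal (x ^ n * V4 x) = ENNReal.ofReal (D4 n) := by
  have hsubst := setLIntegral_Ioo_eq_setLIntegral_deriv_mul (g := fun y => 16 * y ^ 2)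
    (g' := fun y => 32 * y) (a := 0) (b := 1) zero_le_one (by fun_prop)
    (fun y hy z _ hlt => by nlinarith [hy.1])
    (fun y _ => ((hasDerivAt_pow 2 y).const_mul 16).congr_deriv (by ring))
    (fun x => ENNReal.ofReal (x ^ n * V4 x))
  have hbeta : ∫⁻ α in Ioo 0 (π / 2), ENNReal.ofReal (cos α ^ (2 * n + 4 + 1)) *
      ENNReal.ofReal (sin α ^ 4 / √(1 - sin α ^ 2) ^ 3) =
        ENNReal.ofReal (trigBeta 4 (2 * n + 2)) := by
    rw [ofReal_trigBeta]
    refine setLIntegral_congr_fun measurableSet_Ioo fun α hα => ?_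
    have hcos := (sin_pos_and_cos_pos_of_mem_Ioo hα).2
    simp only [← cos_sq', sqrt_sq hcos.le]
    rw [← ENNReal.ofReal_mul (by positivity)]
    congr 1
    field_simp
    ring
  simp only [ne_eq, OfNat.ofNat_ne_zero, not_false_eq_true, zero_pow, one_pow, mul_zero,
    mul_one] at hsubst
  rw [hsubst, setLIntegral_congr_fun measurableSet_Ioo fun y hy =>
      ofReal_mul_pow_mul_V4_sixteen_mul_sq n hy,
    lintegral_const_mul' _ _ ENNReal.ofReal_ne_top,
    lintegral_octant_pow_mul_pow_mul (2 * n) 4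
      (G := fun c => ENNReal.ofReal (c ^ 4 / √(1 - c ^ 2) ^ 3)) (by fun_prop),
    hbeta, ← ofReal_trigBeta, ← trigBeta_mul_trigBeta_eq_D4, ENNReal.ofReal_mul (by positivity),
    ENNReal.ofReal_mul (trigBeta_two_mul_two_mul n 2 ▸ by positivity)]

theorem solvesMomentProblem_V4 : SolvesMomentProblem V4 := by
  intro n
  have hmeas : AEStronglyMeasurable (fun x => x ^ n * V4 x) (volume.restrict (Ioo 0 16)) :=
    (Measurable.mul (by fun_prop) measurable_V4).aestronglyMeasurable
  have hnonneg : 0 ≤ᵐ[volume.restrict (Ioo 0 16)] fun x => x ^ n * V4 x :=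
    (ae_restrict_iff' measurableSet_Ioo).2
      (.of_forall fun x hx => mul_nonneg (pow_nonneg hx.1.le n) (V4_pos hx).le)
  have hD4 : 0 ≤ D4 n := by unfold D4; positivity
  constructor
  · rw [intervalIntegrable_iff_integrableOn_Ioo_of_le (by norm_num)]
    refine ⟨hmeas, (hasFiniteIntegral_iff_ofReal hnonneg).2 ?_⟩
    rw [lintegral_pow_mul_V4]
    exact ENNReal.ofReal_lt_top
  · rw [intervalIntegral.integral_of_le (by norm_num), integral_Ioc_eq_integral_Ioo,
      integral_eq_lintegral_of_nonneg_ae hnonneg hmeas, lintegral_pow_mul_V4,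
      ENNReal.toReal_ofReal hD4]

end Moments

section Uniqueness

open Set

variable {a b : ℝ} {f : ℝ → ℝ}

theorem integral_polynomial_mul_eq_zero (hf : IntervalIntegrable f volume a b)
    (hmom : ∀ n : ℕ, ∫ x in a..b, x ^ n * f x = 0) (p : Polynomial ℝ) :
    ∫ x in a..b, p.eval x * f x = 0 := by
  induction p using Polynomial.induction_on' with
  | add p q hp hq =>
    simp only [Polynomial.eval_add, add_mul]
    rw [intervalIntegral.integral_add (hf.continuousOn_mul p.continuous.continuousOn)
      (hf.continuousOn_mul q.continuous.continuousOn), hp, hq, add_zero]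
  | monomial n c =>
    simp only [Polynomial.eval_monomial, mul_assoc]
    rw [intervalIntegral.integral_const_mul, hmom, mul_zero]

theorem abs_integral_mul_le_of_abs_le (hab : a ≤ b) (hf : IntervalIntegrable f volume a b)
    {g : ℝ → ℝ} (hg : ContinuousOn g (Icc a b)) {ε : ℝ} (hε : ∀ x ∈ Icc a b, |g x| ≤ ε) :
    |∫ x in a..b, g x * f x| ≤ ε * ∫ x in a..b, |f x| := by
  rw [← intervalIntegral.integral_const_mul]
  refine (intervalIntegral.abs_integral_le_integral_abs hab).trans
    (intervalIntegral.integral_mono_on hab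
      (hf.continuousOn_mul (by rwa [uIcc_of_le hab])).abs (hf.abs.const_mul ε) fun x hx => ?_)
  rw [abs_mul]
  exact mul_le_mul_of_nonneg_right (hε x hx) (abs_nonneg _)

theorem integral_continuousOn_mul_eq_zero (hab : a ≤ b) (hf : IntervalIntegrable f volume a b)
    (hmom : ∀ n : ℕ, ∫ x in a..b, x ^ n * f x = 0) {g : ℝ → ℝ} (hg : ContinuousOn g (Icc a b)) :
    ∫ x in a..b, g x * f x = 0 := by
  have hbound {ε : ℝ} (hε : 0 < ε) : |∫ x in a..b, g x * f x| ≤ ε * ∫ x in a..b, |f x| := by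
    obtain ⟨p, hp⟩ := exists_polynomial_near_of_continuousOn a b g hg ε hε
    have hsub : ∫ x in a..b, g x * f x = ∫ x in a..b, (g x - p.eval x) * f x := by
      simp only [sub_mul]
      rw [intervalIntegral.integral_sub (hf.continuousOn_mul (by rwa [uIcc_of_le hab]))
        (hf.continuousOn_mul p.continuous.continuousOn),
        integral_polynomial_mul_eq_zero hf hmom, sub_zero]
    rw [hsub]
    exact abs_integral_mul_le_of_abs_le hab hf (hg.sub p.continuous.continuousOn) fun x hx =>
      abs_sub_comm (g x) _ ▸ (hp x hx).le
  have hlim : Filter.Tendsto (fun ε => ε * ∫ x in a..b, |f x|) (nhdsWithin 0 (Ioi 0)) (nhds 0) :=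
    tendsto_nhdsWithin_of_tendsto_nhds (Continuous.tendsto' (by fun_prop) _ _ (zero_mul _))
  exact abs_nonpos_iff.1 (ge_of_tendsto hlim (eventually_mem_nhdsWithin.mono fun _ hε => hbound hε))

theorem ae_eq_zero_of_moments_eq_zero (hab : a ≤ b) (hf : IntervalIntegrable f volume a b)
    (hmom : ∀ n : ℕ, ∫ x in a..b, x ^ n * f x = 0) :
    ∀ᵐ x ∂(volume.restrict (Icc a b)), f x = 0 := by
  have hloc : LocallyIntegrableOn f (Ioo a b) :=
    ((intervalIntegrable_iff_integrableOn_Ioo_of_le hab).1 hf).locallyIntegrableOn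
  rw [← restrict_Ioo_eq_restrict_Icc, ae_restrict_iff' measurableSet_Ioo]
  refine isOpen_Ioo.ae_eq_zero_of_integral_contDiff_smul_eq_zero hloc fun g hg _ hsupp => ?_
  have hzero : ∀ x ∉ Ioo a b, g x • f x = 0 := fun x hx => by
    rw [image_eq_zero_of_notMem_tsupport fun h => hx (hsupp h), zero_smul]
  rw [← setIntegral_eq_integral_of_forall_compl_eq_zero hzero, ← integral_Ioc_eq_integral_Ioo,
    ← intervalIntegral.integral_of_le hab]
  exact integral_continuousOn_mul_eq_zero hab hf hmom hg.continuous.continuousOn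

theorem SolvesMomentProblem.ae_eq {V W : ℝ → ℝ} (hV : SolvesMomentProblem V)
    (hW : SolvesMomentProblem W) : ∀ᵐ x ∂(volume.restrict (Icc (0 : ℝ) 16)), W x = V x := by
  have hint {U : ℝ → ℝ} (hU : SolvesMomentProblem U) : IntervalIntegrable U volume 0 16 := by
    simpa only [pow_zero, one_mul] using (hU 0).1
  have hzero := ae_eq_zero_of_moments_eq_zero (by norm_num) ((hint hW).sub (hint hV)) fun n => by
    simp only [mul_sub]
    rw [intervalIntegral.integral_sub (hW n).1 (hV n).1, (hW n).2, (hV n).2, sub_self]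
  filter_upwards [hzero] with x hx using sub_eq_zero.1 hx

end Uniqueness

theorem mainTheorem4 :
    SolvesMomentProblem V4 ∧
    (∀ x ∈ Set.Ioo (0 : ℝ) 16, 0 < V4 x) ∧
    (∀ W : ℝ → ℝ, SolvesMomentProblem W →
      ∀ᵐ x ∂(volume.restrict (Set.Icc (0 : ℝ) 16)), W x = V4 x) :=
  ⟨solvesMomentProblem_V4, fun _ hx => V4_pos hx, fun _ hW => solvesMomentProblem_V4.ae_eq hW⟩
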